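/- Let $n\ge 2$ and $N=\{1,\dots,n\}$. A \emph{game} consists of measurable spaces $(T_i,\mathcal F_i)$, $i\in N$ (the type spaces), a probability measure $\mu$ (the prior) on $T=T_1\times\dots\times T_n$ with the product $\sigma$-algebra, not necessarily a product measure, and a measurable outcome function $a:T\to\Delta(N)$, where $\Delta(N)$ is the set of probability vectors on $N$ and $a(i,t)$ is the probability that agent $i$ wins at the type profile $t$. The posterior belief of agent $i$ of type $t_i$ that she wins is $$Q_i(t_i)=\int_{T_{-i}}a(i,t_i,t_{-i})\,d\mu(t_{-i}\mid t_i)\in[0,1],\qquad i\in N,\ t_i\in T_i, \tag{1}$$ where $\mu(\cdot\mid t_i)$ is a (version of the) regular conditional distribution under $\mu$ of the other agents' types given $t_i$. A Borel probability measure $\nu$ on $[0,1]^n$ is \emph{feasible} if there are a game and measurable functions $Q_i:T_i\to[0,1]$ that satisfy (1) such that $\nu$ is the distribution of $(Q_1(t_1),\dots,Q_n(t_n))$ under $\mu$. Theorem. A Borel probability measure $\nu$ on $[0,1]^n$, with marginals $\nu_1,\dots,\nu_n$, is feasible if and only if $$\sum_{i\in N}\int_{C_i}x_i\,d\nu_i(x_i)\le\nu\Big(\bigcup_{i\in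 N}\{x\in[0,1]^n: x_i\in C_i\}\Big)\quad\text{for all measurable }C_1,\dots,C_n\subseteq[0,1],$$ and $$\sum_{i\in N}\int_{[0,1]}x_i\,d\nu_i(x_i)=1.$$ The same equivalence holds if (1) is read in the almost sure sense, which makes sense for every prior: $Q_i(t_i)$ is a version of the conditional expectation of $a(i,t)$ given $t_i$ under $\mu$. -/

import Mathlib

open MeasureTheory ProbabilityTheory

universe u

/-- A game with `n` agents: arbitrary measurable type spaces `T i`, a (possibly correlated) prior
probability measure on the product `σ`-algebra of type profiles, and a measurable outcome function
into the simplex `Δ(N)` of probability vectors over the agents. -/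
structure Game (n : ℕ) where
  /-- the type space of each agent -/
  T : Fin n → Type u
  /-- the `σ`-algebra on each type space -/
  measurableSpace : ∀ i, MeasurableSpace (T i)
  /-- the prior on type profiles -/
  prior : Measure (∀ i, T i)
  /-- the prior is a probability measure -/
  isProbabilityMeasure : IsProbabilityMeasure prior
  /-- the probabilities of winning at each type profile -/
  outcome : (∀ i, T i) → stdSimplex ℝ (Fin n)
  /-- the outcome function is measurable -/
  measurable_outcome : Measurable outcome

attribute [instance] Game.measurableSpace Game.isProbabilityMeasure

namespace Game

variable {n : ℕ}

/-- The probability `a(i, t)` that agent `i` wins at the type profile `t`. -/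
def win (G : Game.{u} n) (i : Fin n) (t : ∀ j, G.T j) : ℝ := (G.outcome t : Fin n → ℝ) i

/-- The marginal `μ_i` of the prior on the types of agent `i`. -/
noncomputable def marginal (G : Game.{u} n) (i : Fin n) : Measure (G.T i) :=
  G.prior.map (fun t => t i)

/-- `κ` is a (regular) conditional distribution `μ(t_{-i} | t_i)` of the other agents' types given
the type of agent `i`: a Markov kernel that disintegrates the prior, read as a measure on
`T_i × T_{-i}`. -/
def IsConditional (G : Game.{u} n) (i : Fin n)
    (κ : Kernel (G.T i) (∀ j : {j // j ≠ i}, G.T j)) : Prop :=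
  IsMarkovKernel κ ∧ G.prior.map (Equiv.piSplitAt i G.T) = (G.marginal i) ⊗ₘ κ

/-- `Q` is the interim outcome function generated by the game: each `Q_i` is a measurable function
of the own type and `Q_i(t_i) = ∫ a(i, t_i, t_{-i}) dμ(t_{-i} | t_i)` for all `i` and all `t_i`. -/
def IsInterim (G : Game.{u} n) (Q : ∀ i, G.T i → unitInterval) : Prop :=
  (∀ i, Measurable (Q i)) ∧
  ∀ i, ∃ κ : Kernel (G.T i) (∀ j : {j // j ≠ i}, G.T j), G.IsConditional i κ ∧
    ∀ ti : G.T i, (Q i ti : ℝ) = ∫ s, G.win i ((Equiv.piSplitAt i G.T).symm (ti, s)) ∂(κ ti)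

/-- The same notion for priors that need not have regular conditional distributions: each `Q_i` is
a measurable function of the own type, and it is a version of the conditional probability of
winning given the own type. -/
def IsInterimCondExp (G : Game.{u} n) (Q : ∀ i, G.T i → unitInterval) : Prop :=
  (∀ i, Measurable (Q i)) ∧
  ∀ i, (fun t => (Q i (t i) : ℝ)) =ᵐ[G.prior]
    G.prior[G.win i | MeasurableSpace.comap (fun t : ∀ j, G.T j => t i) (G.measurableSpace i)]

/-- The joint distribution of the vector of beliefs `(Q_1(t_1), …, Q_n(t_n))` under the prior. -/
noncomputable def beliefLaw (G : Game.{u} n) (Q : ∀ i, G.T i → unitInterval) :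
    Measure (Fin n → unitInterval) :=
  G.prior.map (fun t i => Q i (t i))

end Game

/-- `ν` is a feasible joint distribution of posterior beliefs for some game, posterior beliefs being
computed at every type from regular conditional distributions of the prior. -/
def IsFeasible {n : ℕ} (ν : Measure (Fin n → unitInterval)) : Prop :=
  ∃ (G : Game.{u} n) (Q : ∀ i, G.T i → unitInterval), G.IsInterim Q ∧ ν = G.beliefLaw Q

/-- `ν` is a feasible joint distribution of posterior beliefs for some game, posterior beliefs being
versions of conditional probabilities (so that arbitrary priors are allowed). -/
def IsFeasibleCondExp {n : ℕ} (ν : Measure (Fin n → unitInterval)) : Prop :=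
  ∃ (G : Game.{u} n) (Q : ∀ i, G.T i → unitInterval), G.IsInterimCondExp Q ∧ ν = G.beliefLaw Q

/-- The Border* inequalities for `ν`, with `ν_i` the `i`-th marginal of `ν`. -/
def BorderStar {n : ℕ} (ν : Measure (Fin n → unitInterval)) : Prop :=
  (∀ C : Fin n → Set unitInterval, (∀ i, MeasurableSet (C i)) →
    ∑ i, ∫ x in C i, (x : ℝ) ∂(ν.map (fun y => y i)) ≤ ν.real (⋃ i, {y | y i ∈ C i})) ∧
  ∑ i, ∫ x, (x : ℝ) ∂(ν.map (fun y => y i)) = 1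

/-!
Necessity. If `Q` is the interim outcome function of a game with winning probabilities `a i`, then
`∫_{C i} x dν_i = ∫ 1{Q i ∈ C i} a i dμ`, because `Q i` is the conditional expectation of `a i`
given the own type. Summing over `i` and bounding `∑ i, a i = 1` on the union of the events
`Q i ∈ C i` gives the inequalities, and taking all `C i` to be everything gives the equality
(`Game.IsInterimCondExp.borderStar`).

Sufficiency. Take the beliefs themselves as types and `ν` as the prior. What is needed is an outcome
function `a` on `[0,1]^n` such that the expectation of `a i` over `{x i ∈ C}` is `∫_C x dν_i`. Such
an `a` is the disintegration of a probability measure `π` on `[0,1]^n × N` ("types and winner") with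
first marginal `ν`, for which `{winner = i, x i ∈ ·}` has the law `m i := x dν_i`. The probability
measures with first marginal `ν` form a weakly compact convex set, so if none of them had the
required laws, Hahn-Banach would provide continuous functions `f i` on `[0,1]` with
`∑ i, ∫ f i dm_i > ∫ f_{winner} (x_{winner}) dπ` for every such `π`; choosing the winner so as to
maximize `f i (x i)`, the right side becomes `∫ max_i f i (x i) dν`. But adding a constant makes the
`f i` nonnegative without affecting the comparison, since the `m i` have masses summing to `1`, and the
layer cake formula together with the inequalities for the sets `C i = {f i > t}` yields the reverse
inequality (`sum_lintegral_le_lintegral_of_layer`, `exists_plan_of_sum_le`). With `a` at hand, the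
belief `Q i` computed from a regular conditional distribution agrees with the type outside a null
set, so that the law of `Q` is `ν`, while the defining formula for `Q i` holds at every type
(`BorderStar.isFeasible`).
-/

/-! ### Separation for compact convex families of functionals -/

/-- Hahn-Banach in the algebraic dual of `F` with the topology of pointwise convergence, whose
continuous functionals are the evaluations at points of `F`: a functional that is dominated at each
`f` by some member of a compact convex family belongs to the family. -/
theorem exists_eq_of_isCompact_of_convex {F X : Type*} [AddCommGroup F] [Module ℝ F]
    [TopologicalSpace X] {K : Set X} (hK : IsCompact K) (T : X → F →ₗ[ℝ] ℝ)
    (hT : ∀ f, Continuous fun x => T x f) (hconv : Convex ℝ (T '' K)) (l : F →ₗ[ℝ] ℝ)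
    (h : ∀ f, ∃ x ∈ K, l f ≤ T x f) : ∃ x ∈ K, T x = l := by
  let B : (F →ₗ[ℝ] ℝ) →ₗ[ℝ] F →ₗ[ℝ] ℝ := LinearMap.id
  let T' : X → WeakBilin B := T
  have hT' : Continuous T' := WeakBilin.continuous_of_continuous_eval B hT
  have hinj : Function.Injective B := fun _ _ h => h
  have : T2Space (WeakBilin B) := (WeakBilin.isEmbedding hinj).t2Space
  have hclosed : IsClosed (T' '' K) := (hK.image hT').isClosed
  by_contra hne
  have hl : (show WeakBilin B from l) ∉ T' '' K := fun ⟨x, hx, hxl⟩ => hne ⟨x, hx, hxl⟩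
  obtain ⟨u, s, hu, hs⟩ := geometric_hahn_banach_closed_point (E := WeakBilin B) hconv hclosed hl
  obtain ⟨f, rfl⟩ := LinearMap.dualEmbedding_surjective B u
  obtain ⟨x, hx, hle⟩ := h f
  have h1 : T x f < s := hu _ ⟨x, hx, rfl⟩
  have h2 : s < l f := hs
  linarith

variable {n : ℕ} {Y : Type*}

/-! ### Measurable maximizers and the layer cake inequality -/

theorem exists_measurable_argmax {X : Type*} [MeasurableSpace X] [NeZero n] {F : Fin n → X → ℝ}
    (hF : ∀ i, Measurable (F i)) :
    ∃ g : X → Fin n, Measurable g ∧ ∀ x j, F j x ≤ F (g x) x := by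
  have hex (x : X) : ∃ i, IsLeast {i | ∀ j, F j x ≤ F i x} i := by
    obtain ⟨i, hi⟩ := Finite.exists_max fun i => F i x
    exact ⟨_, wellFounded_lt.min_mem {i | ∀ j, F j x ≤ F i x} ⟨i, hi⟩,
      fun k hk => not_lt.1 (wellFounded_lt.not_lt_min _ hk)⟩
  -- The least maximizer is unique, which makes the fibres of the selection explicit.
  choose g hg using hex
  refine ⟨g, measurable_to_countable' fun i => ?_, fun x => (hg x).1⟩
  have : g ⁻¹' {i} = {x | (∀ j, F j x ≤ F i x) ∧ ∀ k, (∀ j, F j x ≤ F k x) → i ≤ k} := by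
    ext x
    exact ⟨fun h => h ▸ hg x, fun h => (hg x).unique h⟩
  rw [this]
  have hm (k : Fin n) : MeasurableSet {x | ∀ j, F j x ≤ F k x} :=
    measurableSet_setOfPred.2 (.forall fun j => (measurableSet_le (hF j) (hF k)).mem)
  exact (hm i).inter (measurableSet_setOfPred.2 (.forall fun k => (hm k).mem.imp measurable_const))

/-- An inequality between measures of sets, applied to the superlevel sets `{f i > t}` and
integrated over `t`, gives an inequality between integrals of nonnegative functions;
`F` stands for a majorant of the functions `f i ∘ e i`, such as their maximum. -/
theorem sum_lintegral_le_lintegral_of_layer {X ι : Type*} [Fintype ι] [MeasurableSpace X]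
    [MeasurableSpace Y] {ν : Measure X} {m : ι → Measure Y} {e : ι → X → Y}
    (hm : ∀ C : ι → Set Y, (∀ i, MeasurableSet (C i)) → ∑ i, m i (C i) ≤ ν (⋃ i, e i ⁻¹' C i))
    {f : ι → Y → ℝ} (hf : ∀ i, Measurable (f i)) (hf0 : ∀ i y, 0 ≤ f i y)
    {F : X → ℝ} (hF : Measurable F) (hle : ∀ i x, f i (e i x) ≤ F x) (hF0 : ∀ x, 0 ≤ F x) :
    ∑ i, ∫⁻ y, ENNReal.ofReal (f i y) ∂m i ≤ ∫⁻ x, ENNReal.ofReal (F x) ∂ν := by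
  rw [lintegral_eq_lintegral_meas_lt ν (.of_forall hF0) hF.aemeasurable]
  simp_rw [fun i => lintegral_eq_lintegral_meas_lt (m i) (.of_forall (hf0 i)) (hf i).aemeasurable]
  rw [← lintegral_finsetSum]
  · refine lintegral_mono fun t => (hm (fun i => {y | t < f i y}) fun i =>
      measurableSet_lt measurable_const (hf i)).trans (measure_mono ?_)
    exact Set.iUnion_subset fun i x hx => lt_of_lt_of_le hx (hle i x)
  · intro i _
    exact Antitone.measurable fun s t hst => measure_mono fun y hy => lt_of_le_of_lt hst hy

/-- For functions of arbitrary sign the layer cake inequality holds because the masses of the `m i` sum to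
one, the mass of `ν`: adding the same constant to all `f i` changes both sides equally. The
maximum of the `f i ∘ e i` is written as the value at a measurable selection of the index. -/
theorem exists_measurable_selection_integral_ge {X : Type*} [NeZero n] [MeasurableSpace X]
    [MeasurableSpace Y] {ν : Measure X} [IsProbabilityMeasure ν] {m : Fin n → Measure Y}
    [∀ i, IsFiniteMeasure (m i)] {e : Fin n → X → Y} (he : ∀ i, Measurable (e i))
    (hm : ∀ C : Fin n → Set Y, (∀ i, MeasurableSet (C i)) →
      ∑ i, m i (C i) ≤ ν (⋃ i, e i ⁻¹' C i))
    (hm1 : ∑ i, (m i).real Set.univ = 1) {f : Fin n → Y → ℝ} (hf : ∀ i, Measurable (f i))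
    {c : ℝ} (hc : ∀ i y, |f i y| ≤ c) :
    ∃ g : X → Fin n, Measurable g ∧ ∑ i, ∫ y, f i y ∂m i ≤ ∫ x, f (g x) (e (g x) x) ∂ν := by
  obtain ⟨g, hg, hmax⟩ := exists_measurable_argmax fun i => (hf i).comp (he i)
  simp only [Function.comp_apply] at hmax
  have hfm (i : Fin n) : Integrable (f i) (m i) :=
    .of_bound (hf i).aestronglyMeasurable c (.of_forall (hc i))
  have hgm : Measurable fun x => f (g x) (e (g x) x) :=
    (measurable_from_prod_countable_right (f := fun p : Fin n × X => f p.1 (e p.1 p.2))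
      fun i => (hf i).comp (he i)).comp (hg.prodMk measurable_id)
  have hgi : Integrable (fun x => f (g x) (e (g x) x)) ν :=
    .of_bound hgm.aestronglyMeasurable c (.of_forall fun x => hc _ _)
  refine ⟨g, hg, ?_⟩
  have h0 (i : Fin n) (y : Y) : 0 ≤ f i y + c := by linarith [neg_le_of_abs_le (hc i y)]
  have key := sum_lintegral_le_lintegral_of_layer hm (f := fun i y => f i y + c)
    (fun i => (hf i).add_const c) h0 (F := fun x => f (g x) (e (g x) x) + c)
    (hgm.add_const c) (fun i x => by simpa using hmax x i) (fun x => h0 _ _)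
  have hfc (i : Fin n) : ∫⁻ y, ENNReal.ofReal (f i y + c) ∂m i =
      ENNReal.ofReal (∫ y, f i y ∂m i + (m i).real Set.univ * c) := by
    rw [← ofReal_integral_eq_lintegral_ofReal (f := fun y => f i y + c)
      ((hfm i).add (integrable_const c)) (.of_forall (h0 i)),
      integral_add (hfm i) (integrable_const c), integral_const, smul_eq_mul]
  have hnn (i : Fin n) : 0 ≤ ∫ y, f i y ∂m i + (m i).real Set.univ * c := by
    rw [← smul_eq_mul, ← integral_const, ← integral_add (hfm i) (integrable_const c)]
    exact integral_nonneg (h0 i)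
  simp_rw [hfc] at key
  rw [← ofReal_integral_eq_lintegral_ofReal (f := fun x => f (g x) (e (g x) x) + c)
      (hgi.add (integrable_const c))
      (.of_forall fun x => h0 _ _), ← ENNReal.ofReal_sum_of_nonneg fun i _ => hnn i,
    ENNReal.ofReal_le_ofReal_iff (integral_nonneg fun x => h0 _ _),
    integral_add hgi (integrable_const c), Finset.sum_add_distrib, ← Finset.sum_mul, hm1] at key
  simp only [integral_const, smul_eq_mul, probReal_univ] at key
  linarith

/-! ### Joint laws of a point and an index -/

/-- A measurable family of random choices of an index, encoded as the joint law `π` of the point and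
the chosen index, such that the `i`-th coordinate on the event that `i` is chosen has the
prescribed law `m i`. Laws with first marginal `ν` are compact and convex, so it suffices to compare
`∑ i, ∫ f i ∂m i` with the best choice of index for each family `f` of continuous functions. -/
theorem exists_plan_of_sum_le [NeZero n] [MetricSpace Y] [CompactSpace Y] [MeasurableSpace Y]
    [BorelSpace Y] {ν : Measure (Fin n → Y)} [IsProbabilityMeasure ν] {m : Fin n → Measure Y}
    [∀ i, IsFiniteMeasure (m i)]
    (hm : ∀ C : Fin n → Set Y, (∀ i, MeasurableSet (C i)) →
      ∑ i, m i (C i) ≤ ν (⋃ i, (fun x => x i) ⁻¹' C i))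
    (hm1 : ∑ i, (m i).real Set.univ = 1) :
    ∃ π : Measure ((Fin n → Y) × Fin n), IsProbabilityMeasure π ∧ π.fst = ν ∧
      ∀ i C, MeasurableSet C → π ({x | x i ∈ C} ×ˢ {i}) = m i C := by
  let F := Fin n → C(Y, ℝ)
  have hcont (f : F) : Continuous fun p : (Fin n → Y) × Fin n => f p.2 (p.1 p.2) :=
    continuous_prod_of_discrete_right.2 fun i => (f i).continuous.comp (continuous_apply i)
  have hint (f : F) (π : Measure ((Fin n → Y) × Fin n)) [IsFiniteMeasure π] :
      Integrable (fun p : (Fin n → Y) × Fin n => f p.2 (p.1 p.2)) π :=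
    (hcont f).integrable_of_hasCompactSupport (HasCompactSupport.of_compactSpace _)
  have hinti (i : Fin n) (g : C(Y, ℝ)) : Integrable g (m i) :=
    g.continuous.integrable_of_hasCompactSupport (HasCompactSupport.of_compactSpace _)
  let T (π : ProbabilityMeasure ((Fin n → Y) × Fin n)) : F →ₗ[ℝ] ℝ :=
    { toFun := fun f => ∫ p : (Fin n → Y) × Fin n, f p.2 (p.1 p.2) ∂(π : Measure _)
      map_add' := fun f g => integral_add (hint f _) (hint g _)
      map_smul' := fun c f => integral_const_mul c _ }
  let l : F →ₗ[ℝ] ℝ :=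
    { toFun := fun f => ∑ i, ∫ y, f i y ∂m i
      map_add' := fun f g => by
        rw [← Finset.sum_add_distrib]
        exact Finset.sum_congr rfl fun i _ => integral_add (hinti i _) (hinti i _)
      map_smul' := fun c f => by
        simp only [RingHom.id_apply, smul_eq_mul, Finset.mul_sum]
        exact Finset.sum_congr rfl fun i _ => integral_const_mul c _ }
  let K : Set (ProbabilityMeasure ((Fin n → Y) × Fin n)) :=
    {π | (π : Measure ((Fin n → Y) × Fin n)).fst = ν}
  have hK : IsCompact K := by
    have hmap : Continuous fun π : ProbabilityMeasure ((Fin n → Y) × Fin n) =>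
        π.map (continuous_fst (X := Fin n → Y) (Y := Fin n)).measurable.aemeasurable :=
      ProbabilityMeasure.continuous_map continuous_fst
    have : K = (fun π : ProbabilityMeasure ((Fin n → Y) × Fin n) =>
        π.map (continuous_fst (X := Fin n → Y) (Y := Fin n)).measurable.aemeasurable) ⁻¹'
          {⟨ν, inferInstance⟩} := by
      ext π
      exact (Subtype.ext_iff (a1 := π.map
        (continuous_fst (X := Fin n → Y) (Y := Fin n)).measurable.aemeasurable)
        (a2 := ⟨ν, inferInstance⟩)).symm
    rw [this]
    exact (isClosed_singleton.preimage hmap).isCompact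
  have hconv : Convex ℝ (T '' K) := by
    rintro _ ⟨π, hπ, rfl⟩ _ ⟨ρ, hρ, rfl⟩ a b ha hb hab
    lift a to NNReal using ha
    lift b to NNReal using hb
    have hab' : (a : ENNReal) + b = 1 := by exact_mod_cast hab
    let σ : ProbabilityMeasure ((Fin n → Y) × Fin n) :=
      ⟨a • (π : Measure _) + b • (ρ : Measure _), ⟨by
        simp only [Measure.add_apply, Measure.smul_apply, measure_univ, ENNReal.smul_def,
          smul_eq_mul, mul_one, hab']⟩⟩
    refine ⟨σ, ?_, ?_⟩
    · change (a • (π : Measure ((Fin n → Y) × Fin n)) +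
        b • (ρ : Measure ((Fin n → Y) × Fin n))).map Prod.fst = ν
      have h1 : (π : Measure ((Fin n → Y) × Fin n)).map Prod.fst = ν := hπ
      have h2 : (ρ : Measure ((Fin n → Y) × Fin n)).map Prod.fst = ν := hρ
      rw [Measure.map_add _ _ measurable_fst, Measure.map_smul, Measure.map_smul,
        h1, h2, ← add_smul, show a + b = 1 by exact_mod_cast hab, one_smul]
    · refine LinearMap.ext fun f => ?_
      change ∫ p : (Fin n → Y) × Fin n, f p.2 (p.1 p.2)
          ∂(a • (π : Measure _) + b • (ρ : Measure _)) =
        a * ∫ p : (Fin n → Y) × Fin n, f p.2 (p.1 p.2) ∂(π : Measure _) +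
        b * ∫ p : (Fin n → Y) × Fin n, f p.2 (p.1 p.2) ∂(ρ : Measure _)
      rw [integral_add_measure (hint f _) (hint f _), integral_smul_nnreal_measure,
        integral_smul_nnreal_measure]
      rfl
  obtain ⟨π, hπ, hTπ⟩ := exists_eq_of_isCompact_of_convex hK T
    (fun f => ProbabilityMeasure.continuous_integral_continuousMap
      (⟨_, hcont f⟩ : C((Fin n → Y) × Fin n, ℝ)))
    hconv l fun f => by
      obtain ⟨c, hc⟩ : ∃ c, ∀ i y, |f i y| ≤ c :=
        ⟨‖f‖, fun i y => ((f i).norm_coe_le_norm y).trans (norm_le_pi_norm f i)⟩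
      obtain ⟨g, hg, hle⟩ := exists_measurable_selection_integral_ge (ν := ν)
        (e := fun i x => x i) (fun i => measurable_pi_apply i) hm hm1
        (fun i => (f i).continuous.measurable) hc
      have hgm : Measurable fun x => (x, g x) := measurable_id.prodMk hg
      refine ⟨⟨ν.map fun x => (x, g x), Measure.isProbabilityMeasure_map hgm.aemeasurable⟩, ?_,
        hle.trans_eq ?_⟩
      · exact (Measure.fst_map_prodMk hg).trans Measure.map_id
      · exact (integral_map hgm.aemeasurable (hcont f).aestronglyMeasurable).symm
  -- Testing on families with the single nonzero member `f i` identifies the law on `{i chosen}`.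
  refine ⟨π, inferInstance, hπ, fun i C hC => ?_⟩
  have hmi : ((π : Measure _).restrict (Set.univ ×ˢ {i})).map
      (fun p : (Fin n → Y) × Fin n => p.1 i) = m i := by
    refine ext_of_forall_integral_eq_of_IsFiniteMeasure fun g => ?_
    have h1 : T π (Pi.single i g.toContinuousMap) = l (Pi.single i g.toContinuousMap) := by rw [hTπ]
    have h2 : l (Pi.single i g.toContinuousMap) = ∫ y, g y ∂m i := by
      change ∑ j, ∫ y, (Pi.single i g.toContinuousMap : F) j y ∂m j = _
      rw [Finset.sum_eq_single i (fun j _ hj => by simp [hj]) (by simp)]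
      simp
    rw [← h2, ← h1, integral_map (by fun_prop) g.continuous.aestronglyMeasurable,
      ← integral_indicator (MeasurableSet.univ.prod (measurableSet_singleton i))]
    refine integral_congr_ae (.of_forall fun p => ?_)
    by_cases hp : p.2 = i
    · subst hp; simp
    · simp [hp]
  have hev : Measurable fun p : (Fin n → Y) × Fin n => p.1 i :=
    (measurable_pi_apply i).comp measurable_fst
  rw [← hmi, Measure.map_apply hev hC, Measure.restrict_apply (hev hC)]
  congr 1
  ext p
  simp

/-! ### The outcome function provided by the inequalities -/

/-- The measure `x dν_i(x)` on `[0,1]`, where `ν_i` is the `i`-th marginal of `ν`. -/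
noncomputable def weightedMarginal {n : ℕ} (ν : Measure (Fin n → unitInterval)) (i : Fin n) :
    Measure unitInterval :=
  (ν.map fun y => y i).withDensity fun x => ENNReal.ofReal x

theorem integrable_coe_unitInterval {μ : Measure unitInterval} [IsFiniteMeasure μ] :
    Integrable (fun x : unitInterval => (x : ℝ)) μ :=
  continuous_subtype_val.integrable_of_hasCompactSupport (HasCompactSupport.of_compactSpace _)

theorem weightedMarginal_apply {n : ℕ} (ν : Measure (Fin n → unitInterval)) [IsFiniteMeasure ν]
    (i : Fin n) {C : Set unitInterval} (hC : MeasurableSet C) :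
    weightedMarginal ν i C = ENNReal.ofReal (∫ x in C, (x : ℝ) ∂(ν.map fun y => y i)) := by
  rw [weightedMarginal, withDensity_apply _ hC,
    ofReal_integral_eq_lintegral_ofReal integrable_coe_unitInterval
      (.of_forall fun x => x.2.1)]

instance {n : ℕ} (ν : Measure (Fin n → unitInterval)) [IsFiniteMeasure ν] (i : Fin n) :
    IsFiniteMeasure (weightedMarginal ν i) :=
  ⟨by rw [weightedMarginal_apply ν i .univ]; exact ENNReal.ofReal_lt_top⟩

/-- The mean of a coordinate may be computed from its law on `ℝ` or from its law on `[0,1]`; the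
normalization in `BorderStar` uses the former, the inequalities the latter. -/
theorem integral_map_coe {n : ℕ} (ν : Measure (Fin n → unitInterval)) (i : Fin n) :
    ∫ x : ℝ, x ∂(ν.map fun y => (y i : ℝ)) =
      ∫ x : unitInterval, (x : ℝ) ∂(ν.map fun y => y i) := by
  have hi : Measurable fun y : Fin n → unitInterval => y i := measurable_pi_apply i
  rw [integral_map (φ := fun y : Fin n → unitInterval => (y i : ℝ))
      (measurable_subtype_coe.comp hi).aemeasurable (by fun_prop),
    integral_map hi.aemeasurable measurable_subtype_coe.aestronglyMeasurable]

/-- If types are drawn from `ν`, there is an outcome function for which the conditional probability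
that agent `i` wins, given that her type is `x`, is `x`. -/
theorem BorderStar.exists_outcome {n : ℕ} [NeZero n] {ν : Measure (Fin n → unitInterval)}
    [IsProbabilityMeasure ν] (h : BorderStar ν) :
    ∃ a : (Fin n → unitInterval) → stdSimplex ℝ (Fin n), Measurable a ∧
      ∀ i C, MeasurableSet C → ∫ x in (fun x => x i) ⁻¹' C, (a x : Fin n → ℝ) i ∂ν =
        ∫ x in C, (x : ℝ) ∂(ν.map fun y => y i) := by
  have hnn (i : Fin n) (C : Set unitInterval) : 0 ≤ ∫ x in C, (x : ℝ) ∂(ν.map fun y => y i) :=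
    integral_nonneg fun x => x.2.1
  obtain ⟨π, hπ, hfst, hπC⟩ := exists_plan_of_sum_le (ν := ν) (m := weightedMarginal ν)
    (fun C hC => by
      simp_rw [fun i => weightedMarginal_apply ν i (hC i)]
      rw [← ENNReal.ofReal_sum_of_nonneg fun i _ => hnn i _]
      exact ENNReal.ofReal_le_of_le_toReal (h.1 C hC))
    (by
      rw [← h.2]
      refine Finset.sum_congr rfl fun i _ => ?_
      rw [measureReal_def, weightedMarginal_apply ν i .univ, ENNReal.toReal_ofReal (hnn i _),
        Measure.restrict_univ, integral_map_coe])
  have hdis : ν ⊗ₘ π.condKernel = π := by rw [← hfst]; exact π.disintegrate _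
  refine ⟨fun x => ⟨fun i => (π.condKernel x).real {i}, fun i => measureReal_nonneg, ?_⟩, ?_, ?_⟩
  · rw [sum_measureReal_singleton, Finset.coe_univ, probReal_univ]
  · exact (measurable_pi_lambda _ fun i =>
      (π.condKernel.measurable_coe (measurableSet_singleton i)).ennreal_toReal).subtype_mk
  · intro i C hC
    have hS : MeasurableSet ((fun x : Fin n → unitInterval => x i) ⁻¹' C) :=
      measurable_pi_apply i hC
    have key : π (((fun x => x i) ⁻¹' C) ×ˢ {i}) = _ := hπC i C hC
    rw [← hdis, Measure.compProd_apply_prod hS (measurableSet_singleton i),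
      weightedMarginal_apply ν i hC] at key
    change ∫ x in _, ((π.condKernel x) {i}).toReal ∂ν = _
    rw [integral_toReal (π.condKernel.measurable_coe (measurableSet_singleton i)).aemeasurable
      (.of_forall fun x => measure_lt_top _ _)]
    exact (congrArg ENNReal.toReal key).trans (ENNReal.toReal_ofReal (hnn i C))

/-! ### Interim outcome functions of games -/

theorem integrable_of_mem_unitInterval {X : Type*} [MeasurableSpace X] {μ : Measure X}
    [IsFiniteMeasure μ] {f : X → ℝ} (hf : Measurable f) (h : ∀ x, f x ∈ unitInterval) :
    Integrable f μ :=
  .of_bound hf.aestronglyMeasurable 1 (.of_forall fun x => by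
    rw [Real.norm_of_nonneg (h x).1]; exact (h x).2)

namespace Game

variable {n : ℕ} (G : Game.{u} n)

theorem win_nonneg (i : Fin n) (t : ∀ j, G.T j) : 0 ≤ G.win i t := (G.outcome t).2.1 i

theorem sum_win (t : ∀ j, G.T j) : ∑ i, G.win i t = 1 := (G.outcome t).2.2

theorem win_le_one (i : Fin n) (t : ∀ j, G.T j) : G.win i t ≤ 1 :=
  (Finset.single_le_sum (fun j _ => G.win_nonneg j t) (Finset.mem_univ i)).trans_eq (G.sum_win t)

theorem measurable_win (i : Fin n) : Measurable (G.win i) :=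
  (measurable_pi_apply i).comp (measurable_subtype_coe.comp G.measurable_outcome)

theorem integrable_win (i : Fin n) : Integrable (G.win i) G.prior :=
  integrable_of_mem_unitInterval (G.measurable_win i)
    fun t => ⟨G.win_nonneg i t, G.win_le_one i t⟩

theorem measurable_piSplitAt (i : Fin n) : Measurable (Equiv.piSplitAt i G.T) :=
  (measurable_pi_apply i).prodMk (measurable_pi_lambda _ fun j => measurable_pi_apply j.1)

theorem measurable_piSplitAt_symm (i : Fin n) : Measurable (Equiv.piSplitAt i G.T).symm := by
  refine measurable_pi_lambda _ fun j => ?_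
  by_cases hj : j = i
  · subst hj
    simpa [Equiv.piSplitAt] using measurable_fst
  · simp only [Equiv.piSplitAt, Equiv.coe_fn_symm_mk, hj, dite_false]
    exact (measurable_pi_apply (⟨j, hj⟩ : {j // j ≠ i})).comp measurable_snd

instance (i : Fin n) : IsProbabilityMeasure (G.marginal i) :=
  Measure.isProbabilityMeasure_map (measurable_pi_apply i).aemeasurable

variable {G}

/-- Integrating the posterior belief computed from a conditional distribution over a set of own
types gives the ex ante probability of winning with such a type. -/
theorem IsConditional.setIntegral_eq {i : Fin n} {κ : Kernel (G.T i) (∀ j : {j // j ≠ i}, G.T j)}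
    (hκ : G.IsConditional i κ) {C : Set (G.T i)} (hC : MeasurableSet C) :
    ∫ ti in C, ∫ s, G.win i ((Equiv.piSplitAt i G.T).symm (ti, s)) ∂(κ ti) ∂(G.marginal i) =
      ∫ t in (fun t => t i) ⁻¹' C, G.win i t ∂G.prior := by
  have := hκ.1
  have hm : Measurable fun p => G.win i ((Equiv.piSplitAt i G.T).symm p) :=
    (G.measurable_win i).comp (G.measurable_piSplitAt_symm i)
  have hint : Integrable (fun p => G.win i ((Equiv.piSplitAt i G.T).symm p))
      (G.marginal i ⊗ₘ κ) :=
    integrable_of_mem_unitInterval hm fun p => ⟨G.win_nonneg i _, G.win_le_one i _⟩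
  have h1 := Measure.setIntegral_compProd hC MeasurableSet.univ hint.integrableOn
  simp only [Measure.restrict_univ] at h1
  rw [← h1, ← hκ.2, setIntegral_map (hC.prod .univ) hm.aestronglyMeasurable
    (G.measurable_piSplitAt i).aemeasurable]
  simp only [Equiv.symm_apply_apply]
  congr 2
  ext t
  simp

theorem IsInterim.isInterimCondExp {Q : ∀ i, G.T i → unitInterval} (h : G.IsInterim Q) :
    G.IsInterimCondExp Q := by
  refine ⟨h.1, fun i => ?_⟩
  obtain ⟨κ, hκ, hQ⟩ := h.2 i
  have hQm : Measurable fun ti => (Q i ti : ℝ) := measurable_subtype_coe.comp (h.1 i)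
  have hQm' : Measurable[MeasurableSpace.comap (fun t : ∀ j, G.T j => t i) (G.measurableSpace i)]
      fun t : ∀ j, G.T j => (Q i (t i) : ℝ) := hQm.comp (comap_measurable _)
  refine ae_eq_condExp_of_forall_setIntegral_eq (measurable_pi_apply i).comap_le
    (G.integrable_win i) (fun s _ _ => ?_) ?_ hQm'.stronglyMeasurable.aestronglyMeasurable
  · exact (integrable_of_mem_unitInterval (hQm.comp (measurable_pi_apply i))
      fun t => (Q i (t i)).2).integrableOn
  · rintro _ ⟨C, hC, rfl⟩ -
    rw [← hκ.setIntegral_eq hC]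
    simp_rw [← hQ]
    rw [marginal, setIntegral_map hC hQm.aestronglyMeasurable (measurable_pi_apply i).aemeasurable]

/-- The left side of the Border* inequality for agent `i` is the probability that she wins with a
belief in `C`. -/
theorem IsInterimCondExp.setIntegral_eq {Q : ∀ i, G.T i → unitInterval} (h : G.IsInterimCondExp Q)
    (i : Fin n) {C : Set unitInterval} (hC : MeasurableSet C) :
    ∫ x in C, (x : ℝ) ∂((G.beliefLaw Q).map fun y => y i) =
      ∫ t in {t | Q i (t i) ∈ C}, G.win i t ∂G.prior := by
  have hQi (j : Fin n) : Measurable fun t : ∀ j, G.T j => Q j (t j) :=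
    (h.1 j).comp (measurable_pi_apply j)
  have hle := (measurable_pi_apply (X := G.T) i).comap_le
  have hmeas : MeasurableSet[MeasurableSpace.comap (fun t : ∀ j, G.T j => t i)
      (G.measurableSpace i)] {t | Q i (t i) ∈ C} := ⟨Q i ⁻¹' C, h.1 i hC, rfl⟩
  rw [beliefLaw, Measure.map_map (measurable_pi_apply i) (measurable_pi_lambda _ hQi),
    setIntegral_map hC measurable_subtype_coe.aestronglyMeasurable
      ((measurable_pi_apply i).comp (measurable_pi_lambda _ hQi)).aemeasurable,
    ← setIntegral_condExp hle (G.integrable_win i) hmeas]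
  exact setIntegral_congr_ae (hle _ hmeas) ((h.2 i).mono fun t ht _ => ht)

theorem IsInterimCondExp.borderStar {Q : ∀ i, G.T i → unitInterval} (h : G.IsInterimCondExp Q) :
    BorderStar (G.beliefLaw Q) := by
  have hQ : Measurable fun (t : ∀ j, G.T j) i => Q i (t i) :=
    measurable_pi_lambda _ fun j => (h.1 j).comp (measurable_pi_apply j)
  have hwin (i : Fin n) (S : Set (∀ j, G.T j)) : IntegrableOn (G.win i) S G.prior :=
    (G.integrable_win i).integrableOn
  refine ⟨fun C hC => ?_, ?_⟩
  · set U : Set (∀ j, G.T j) := ⋃ i, {t | Q i (t i) ∈ C i}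
    calc ∑ i, ∫ x in C i, (x : ℝ) ∂((G.beliefLaw Q).map fun y => y i)
        = ∑ i, ∫ t in {t | Q i (t i) ∈ C i}, G.win i t ∂G.prior :=
          Finset.sum_congr rfl fun i _ => h.setIntegral_eq i (hC i)
      _ ≤ ∑ i, ∫ t in U, G.win i t ∂G.prior := Finset.sum_le_sum fun i _ =>
          setIntegral_mono_set (hwin i U) (.of_forall fun t => G.win_nonneg i t)
            (Set.subset_iUnion (fun i => {t : ∀ j, G.T j | Q i (t i) ∈ C i}) i).eventuallyLE
      _ = ∫ t in U, ∑ i, G.win i t ∂G.prior := (integral_finsetSum _ fun i _ => hwin i U).symm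
      _ = G.prior.real U := by simp [sum_win]
      _ = (G.beliefLaw Q).real (⋃ i, {y | y i ∈ C i}) :=
          (congrArg G.prior.real (Set.preimage_iUnion ..).symm).trans
            (map_measureReal_apply hQ (.iUnion fun i => measurable_pi_apply i (hC i))).symm
  · calc ∑ i, ∫ x : ℝ, x ∂((G.beliefLaw Q).map fun y => (y i : ℝ))
        = ∑ i, ∫ t, G.win i t ∂G.prior := Finset.sum_congr rfl fun i _ => by
          rw [integral_map_coe]
          simpa using h.setIntegral_eq i .univ
      _ = ∫ t, ∑ i, G.win i t ∂G.prior :=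
          (integral_finsetSum _ fun i _ => G.integrable_win i).symm
      _ = 1 := by simp [sum_win]

end Game

/-! ### Feasibility -/

theorem IsFeasible.isFeasibleCondExp {n : ℕ} {ν : Measure (Fin n → unitInterval)}
    (h : IsFeasible.{u} ν) : IsFeasibleCondExp.{u} ν :=
  let ⟨G, Q, hQ, hν⟩ := h
  ⟨G, Q, hQ.isInterimCondExp, hν⟩

theorem IsFeasibleCondExp.borderStar {n : ℕ} {ν : Measure (Fin n → unitInterval)}
    (h : IsFeasibleCondExp.{u} ν) : BorderStar ν := by
  obtain ⟨G, Q, hQ, rfl⟩ := h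
  exact hQ.borderStar

/-- The game in which types are (intended) beliefs, drawn from `ν`, and the outcome function is `a`.
The type spaces are lifted copies of `[0,1]`, in order to live in an arbitrary universe. -/
noncomputable def directGame {n : ℕ} (ν : Measure (Fin n → unitInterval)) [IsProbabilityMeasure ν]
    (a : (Fin n → unitInterval) → stdSimplex ℝ (Fin n)) (ha : Measurable a) : Game.{u} n where
  T _ := ULift.{u} unitInterval
  measurableSpace _ := inferInstance
  prior := ν.map fun x i => ULift.up (x i)
  isProbabilityMeasure := Measure.isProbabilityMeasure_map
    (measurable_pi_lambda _ fun i => measurable_up.comp (measurable_pi_apply i)).aemeasurable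
  outcome t := a fun i => (t i).down
  measurable_outcome := ha.comp
    (measurable_pi_lambda _ fun i => measurable_down.comp (measurable_pi_apply i))

/-- In the direct game, posterior beliefs are defined from a conditional kernel at every type; they
coincide with the types only almost surely, which is enough for their law to be `ν`. -/
theorem BorderStar.isFeasible {n : ℕ} [NeZero n] {ν : Measure (Fin n → unitInterval)}
    [IsProbabilityMeasure ν] (h : BorderStar ν) : IsFeasible.{u} ν := by
  obtain ⟨a, ha, haC⟩ := h.exists_outcome
  let G : Game.{u} n := directGame ν a ha
  have hup : Measurable fun (x : Fin n → unitInterval) i => ULift.up.{u} (x i) :=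
    measurable_pi_lambda _ fun i => measurable_up.comp (measurable_pi_apply i)
  have hker (i : Fin n) : ∃ κ : Kernel (G.T i) (∀ j : {j // j ≠ i}, G.T j),
      G.IsConditional i κ := by
    have : ∀ j : {j // j ≠ i}, StandardBorelSpace (G.T j) := fun j =>
      inferInstanceAs (StandardBorelSpace (ULift.{u} unitInterval))
    have : ∀ j : {j // j ≠ i}, Nonempty (G.T j) := fun j => ⟨ULift.up 0⟩
    have := Measure.isProbabilityMeasure_map (μ := G.prior)
      (G.measurable_piSplitAt i).aemeasurable
    refine ⟨(G.prior.map (Equiv.piSplitAt i G.T)).condKernel, inferInstance, ?_⟩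
    have hfst : G.marginal i = (G.prior.map (Equiv.piSplitAt i G.T)).fst := by
      rw [Measure.fst, Measure.map_map measurable_fst (G.measurable_piSplitAt i)]
      rfl
    rw [hfst]
    exact (Measure.disintegrate _ _).symm
  choose κ hκ using hker
  have hκM (i : Fin n) : IsMarkovKernel (κ i) := (hκ i).1
  have hwin (i : Fin n) : Measurable fun p => G.win i ((Equiv.piSplitAt i G.T).symm p) :=
    (G.measurable_win i).comp (G.measurable_piSplitAt_symm i)
  have hle (i : Fin n) (ti : G.T i) :
      ∫ s, G.win i ((Equiv.piSplitAt i G.T).symm (ti, s)) ∂(κ i ti) ≤ 1 := by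
    refine (integral_mono (integrable_of_mem_unitInterval
      ((hwin i).comp measurable_prodMk_left) fun s => ⟨G.win_nonneg i _, G.win_le_one i _⟩)
      (integrable_const 1) fun s => G.win_le_one i _).trans ?_
    simp
  let Q (i : Fin n) (ti : G.T i) : unitInterval :=
    ⟨∫ s, G.win i ((Equiv.piSplitAt i G.T).symm (ti, s)) ∂(κ i ti),
      integral_nonneg fun s => G.win_nonneg i _, hle i ti⟩
  have hQm (i : Fin n) : Measurable (Q i) :=
    ((hwin i).stronglyMeasurable.integral_kernel_prod_right' (κ := κ i)).measurable.subtype_mk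
  refine ⟨G, Q, ⟨hQm, fun i => ⟨κ i, hκ i, fun ti => rfl⟩⟩, ?_⟩
  have hae (i : Fin n) : (fun ti => (Q i ti : ℝ)) =ᵐ[G.marginal i] fun ti => (ti.down : ℝ) := by
    have hdown : Measurable fun ti : G.T i => (ti.down : ℝ) :=
      measurable_subtype_coe.comp measurable_down
    refine Integrable.ae_eq_of_forall_setIntegral_eq _ _
      (integrable_of_mem_unitInterval (measurable_subtype_coe.comp (hQm i)) fun ti => (Q i ti).2)
      (integrable_of_mem_unitInterval hdown fun ti => ti.down.2) fun C hC _ => ?_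
    have hC' : MeasurableSet (ULift.up ⁻¹' C) := measurable_up hC
    change ∫ ti in C, ∫ s, G.win i ((Equiv.piSplitAt i G.T).symm (ti, s)) ∂(κ i ti)
      ∂(G.marginal i) = _
    rw [(hκ i).setIntegral_eq hC]
    have h1 : ∫ t in (fun t => t i) ⁻¹' C, G.win i t ∂G.prior =
        ∫ x in (fun x => x i) ⁻¹' (ULift.up ⁻¹' C), (a x : Fin n → ℝ) i ∂ν :=
      setIntegral_map (measurable_pi_apply i hC) (G.measurable_win i).aestronglyMeasurable
        hup.aemeasurable
    have h2 : G.marginal i = (ν.map fun y => y i).map ULift.up :=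
      (Measure.map_map (measurable_pi_apply i) hup).trans
        (Measure.map_map measurable_up (measurable_pi_apply i)).symm
    rw [h1, haC i _ hC', h2]
    exact (setIntegral_map hC hdown.aestronglyMeasurable measurable_up.aemeasurable).symm
  have hae' : (fun (t : ∀ j, G.T j) i => Q i (t i)) =ᵐ[G.prior] fun t i => (t i).down := by
    have := fun i => ae_of_ae_map (μ := G.prior) (measurable_pi_apply i).aemeasurable (hae i)
    filter_upwards [ae_all_iff.2 this] with t ht
    exact funext fun i => Subtype.ext (ht i)
  rw [Game.beliefLaw, Measure.map_congr hae']
  change ν = (ν.map fun x i => ULift.up (x i)).map fun t i => (t i).down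
  have hdown : Measurable fun (t : Fin n → ULift.{u} unitInterval) i => (t i).down :=
    measurable_pi_lambda _ fun i => measurable_down.comp (measurable_pi_apply i)
  exact ((Measure.map_map hdown hup).trans Measure.map_id).symm

theorem theorem1 (n : ℕ) (hn : 2 ≤ n)
    (ν : Measure (Fin n → unitInterval)) [IsProbabilityMeasure ν] :
    (IsFeasible.{u} ν ↔ BorderStar ν) ∧ (IsFeasibleCondExp.{u} ν ↔ BorderStar ν) := by
  have : NeZero n := ⟨by omega⟩
  exact ⟨⟨fun h => h.isFeasibleCondExp.borderStar, fun h => h.isFeasible⟩,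
    ⟨fun h => h.borderStar, fun h => h.isFeasible.isFeasibleCondExp⟩⟩
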